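/- Let $\mathbb F$ be a field, let $z=(z_1,\dots,z_n)$ be $n\ge 1$ indeterminates, and let $\mathbb F(z)$ be the field of rational functions in $z$ over $\mathbb F$. For an integer $d$ let $\mathbb F(z)_d\subseteq\mathbb F(z)$ be the set of rational functions homogeneous of degree $d$, i.e. of quotients $p/q$ of homogeneous polynomials $p,q\in\mathbb F[z]$ with $q\ne 0$ and either $p=0$ or $\deg p-\deg q=d$. A linear matrix pencil is a matrix $A(z)=A_0+z_1A_1+\cdots+z_nA_n$ with $A_0,\dots,A_n\in\mathbb F^{m\times m}$; it is symmetric if all $A_j$ are symmetric, and homogeneous if $A_0=0$. A matrix $F(z)\in\mathbb F(z)^{k\times k}$ has a Bessmertnyĭ realization (BR) if there is a linear matrix pencil $A(z)=\begin{bmatrix}A_{11}(z)&A_{12}(z)\\A_{21}(z)&A_{22}(z)\end{bmatrix}$, partitioned in $2\times2$ block form with square diagonal blocks, such that $A_{22}(z)$ is invertible over $\mathbb F(z)$ and $$F(z)=A_{11}(z)-A_{12}(z)A_{22}(z)^{-1}A_{21}(z).$$ It has a symmetric BR (SBR), a homogeneous BR (hBR), or a homogeneous symmetric BR (hSBR)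 if $A(z)$ can be chosen symmetric, homogeneous, or both homogeneous and symmetric, respectively. Theorem. Let $F(z)\in\mathbb F(z)^{k\times k}$. Then: (a) $F(z)$ has a BR. (b) $F(z)$ has an hBR if and only if $F(z)\in\mathbb F(z)_1^{k\times k}$. (c) $F(z)$ has an SBR if and only if $F(z)^T=F(z)$ and at least one of the following holds: (i) $n=1$; (ii) $\operatorname{char}(\mathbb F)\neq 2$; (iii) $n\ge 2$, $\operatorname{char}(\mathbb F)=2$, and every diagonal entry of $F(z)$ lies in $$\operatorname{span}_{\mathbb F}\{q_0^2+z_1q_1^2+\cdots+z_nq_n^2 : q_0,\dots,q_n\in\mathbb F(z)\}.$$ (d) $F(z)$ has an hSBR if and only if $F(z)\in\mathbb F(z)_1^{k\times k}$, $F(z)^T=F(z)$, and at least one of the following holds: (i) $n\in\{1,2\}$; (ii) $\operatorname{char}(\mathbb F)\neq2$; (iii) $n\ge 3$, $\operatorname{char}(\mathbb F)=2$, and every diagonal entry of $F(z)$ lies in $$\operatorname{span}_{\mathbb F}\{z_1q_1^2+\cdots+z_nq_n^2 : q_1,\dots,q_n\in\mathbb F(z)_0\}.$$ -/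

import Mathlib

open scoped Matrix

noncomputable section

namespace Bessmertnyi

/-- The field `F(z)` of rational functions in the `n` indeterminates `z_1, …, z_n`. -/
abbrev RationalField (F : Type*) [Field F] (n : ℕ) : Type _ :=
  FractionRing (MvPolynomial (Fin n) F)

/-- The `i`-th indeterminate, as an element of `F(z)`. -/
def indet (F : Type*) [Field F] {n : ℕ} (i : Fin n) : RationalField F n :=
  algebraMap (MvPolynomial (Fin n) F) (RationalField F n) (MvPolynomial.X i)

/-- `r ∈ F(z)_d`: `r` is a quotient `p / q` of homogeneous polynomials with
`deg p = deg q + d`. The zero function is homogeneous of degree `d`, as `p = 0` is allowed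
(Mathlib's `IsHomogeneous` holds for `0` in every degree). -/
def IsHomogeneousRat {F : Type*} [Field F] {n : ℕ} (d : ℤ) (r : RationalField F n) : Prop :=
  ∃ (a b : ℕ) (p q : MvPolynomial (Fin n) F),
    p.IsHomogeneous a ∧ q.IsHomogeneous b ∧ q ≠ 0 ∧ (a : ℤ) = b + d ∧
      r = algebraMap (MvPolynomial (Fin n) F) (RationalField F n) p /
        algebraMap (MvPolynomial (Fin n) F) (RationalField F n) q

/-- An affine linear matrix pencil in `n` indeterminates with rows and columns indexed by `ι`,
given by its (uniquely determined) coefficient matrices `A_0` and `A_1, …, A_n` over `F`. -/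
structure LinearPencil (F : Type*) [Field F] (n : ℕ) (ι : Type*) where
  /-- The constant coefficient `A_0`. -/
  const : Matrix ι ι F
  /-- The coefficients `A_1, …, A_n` of the indeterminates. -/
  coeff : Fin n → Matrix ι ι F

namespace LinearPencil

variable {F : Type*} [Field F] {n : ℕ} {ι : Type*}

/-- The polynomial matrix `A(z) = A_0 + z_1 A_1 + ⋯ + z_n A_n`. -/
def toPolyMatrix (A : LinearPencil F n ι) : Matrix ι ι (MvPolynomial (Fin n) F) :=
  A.const.map MvPolynomial.C +
    ∑ i, (MvPolynomial.X i : MvPolynomial (Fin n) F) • (A.coeff i).map MvPolynomial.C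

/-- The matrix `A(z)`, with entries regarded as elements of `F(z)`. -/
def toMatrix (A : LinearPencil F n ι) : Matrix ι ι (RationalField F n) :=
  A.toPolyMatrix.map (algebraMap (MvPolynomial (Fin n) F) (RationalField F n))

/-- Every coefficient matrix `A_0, A_1, …, A_n` is symmetric. -/
def IsSymmetric (A : LinearPencil F n ι) : Prop :=
  A.constᵀ = A.const ∧ ∀ i, (A.coeff i)ᵀ = A.coeff i

/-- The constant coefficient `A_0` vanishes. -/
def IsHomogeneous (A : LinearPencil F n ι) : Prop :=
  A.const = 0

end LinearPencil

/-- The Schur complement `N / N₂₂ = N₁₁ - N₁₂ N₂₂⁻¹ N₂₁` of a `2 × 2` block matrix with respect to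
its lower right block; meaningful when `N₂₂` is invertible. -/
def schurComplement {K : Type*} [Field K] {k l : ℕ}
    (N : Matrix (Fin k ⊕ Fin l) (Fin k ⊕ Fin l) K) : Matrix (Fin k) (Fin k) K :=
  N.toBlocks₁₁ - N.toBlocks₁₂ * N.toBlocks₂₂⁻¹ * N.toBlocks₂₁

/-- The pencil `A(z)`, partitioned in `2 × 2` block form with blocks of sizes `k` and `l`,
is a Bessmertnyĭ realizer of `M`: `A₂₂(z)` is invertible over `F(z)` and `M = A(z) / A₂₂(z)`. -/
def IsRealizer {F : Type*} [Field F] {n k l : ℕ} (A : LinearPencil F n (Fin k ⊕ Fin l))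
    (M : Matrix (Fin k) (Fin k) (RationalField F n)) : Prop :=
  IsUnit A.toMatrix.toBlocks₂₂ ∧ M = schurComplement A.toMatrix

section Realizations

variable {F : Type*} [Field F] {n k : ℕ}

/-- `M` has a Bessmertnyĭ realization. -/
def HasBR (M : Matrix (Fin k) (Fin k) (RationalField F n)) : Prop :=
  ∃ l : ℕ, 0 < l ∧ ∃ A : LinearPencil F n (Fin k ⊕ Fin l), IsRealizer A M

/-- `M` has a symmetric Bessmertnyĭ realization. -/
def HasSBR (M : Matrix (Fin k) (Fin k) (RationalField F n)) : Prop :=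
  ∃ l : ℕ, 0 < l ∧ ∃ A : LinearPencil F n (Fin k ⊕ Fin l), A.IsSymmetric ∧ IsRealizer A M

/-- `M` has a homogeneous Bessmertnyĭ realization. -/
def HasHBR (M : Matrix (Fin k) (Fin k) (RationalField F n)) : Prop :=
  ∃ l : ℕ, 0 < l ∧ ∃ A : LinearPencil F n (Fin k ⊕ Fin l), A.IsHomogeneous ∧ IsRealizer A M

/-- `M` has a homogeneous symmetric Bessmertnyĭ realization. -/
def HasHSBR (M : Matrix (Fin k) (Fin k) (RationalField F n)) : Prop :=
  ∃ l : ℕ, 0 < l ∧ ∃ A : LinearPencil F n (Fin k ⊕ Fin l),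
    A.IsHomogeneous ∧ A.IsSymmetric ∧ IsRealizer A M

end Realizations

/-- The `F`-linear span of `{q_0² + z_1 q_1² + ⋯ + z_n q_n² : q_i ∈ F(z)}`. -/
def squareSpan (F : Type*) [Field F] (n : ℕ) : Submodule F (RationalField F n) :=
  Submodule.span F {r | ∃ (q₀ : RationalField F n) (q : Fin n → RationalField F n),
    r = q₀ ^ 2 + ∑ i, indet F i * q i ^ 2}

/-- The `F`-linear span of `{z_1 q_1² + ⋯ + z_n q_n² : q_i ∈ F(z)_0}`. -/
def homogeneousSquareSpan (F : Type*) [Field F] (n : ℕ) : Submodule F (RationalField F n) :=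
  Submodule.span F {r | ∃ q : Fin n → RationalField F n,
    (∀ i, IsHomogeneousRat 0 (q i)) ∧ r = ∑ i, indet F i * q i ^ 2}

end Bessmertnyi

end

open scoped Matrix

noncomputable section

/-! Affine and homogeneous pencils are treated at once. Let `V` be the space of admissible entries
(affine or linear forms) and `t` a nonzero element of `V` (`1` or an indeterminate). Realizable
matrices are closed under sums, under constant factors on both sides and, by the quotient property,
under Schur complements (`Realizable.schur`). Hence realizable scalars are closed under `f g⁻¹ h`,
and the `a` with `t a` realizable form a field containing `V / t`. This field is all of `F(z)` in
the affine case and contains every rational function of degree 0 in the homogeneous case, which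
settles the nonsymmetric statements.

For symmetric pencils, `c (M + Mᵀ)` is always symmetrically realizable
(`Realizable.add_transpose_smul`); `c = 1/2` suffices when 2 is invertible. In general `M = U + Uᵀ +
diagonal`, and a diagonal entry may be any combination of terms `ℓ q²` with `ℓ ∈ V`
(`realizable_mul_sq`). If `t` and one more element span `V`, writing `r / s = r s / s²` shows that
every relevant entry has this form.

Conversely, a symmetric realization reads `M = A - Xᵀ D X`. In characteristic 2 the cross terms on
the diagonal cancel, leaving `A i i - ∑ D a a (X a i)²`. In the homogeneous case `X = D⁻¹ C` has
degree 0, and so `M` has degree 1. -/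

namespace Bessmertnyi

/-! ### Closure properties of realizable matrices over an arbitrary space of entries. -/

section Abstract

variable {F K : Type*} [Field F] [Field K] [Algebra F K]

/-- `M = A - B D⁻¹ C` for matrices `A`, `B`, `C`, `D` with entries in the space `V` of linear forms,
with `D` invertible, and forming a symmetric block matrix if `s` holds. The matrix `X` stands for
`D⁻¹ C`. -/
def Realizable (V : Submodule F K) (s : Prop) {κ : Type*} (M : Matrix κ κ K) : Prop :=
  ∃ (ι : Type) (_ : Fintype ι) (_ : DecidableEq ι) (A : Matrix κ κ K) (B : Matrix κ ι K)
    (C : Matrix ι κ K) (D : Matrix ι ι K) (X : Matrix ι κ K),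
    ((∀ i j, A i j ∈ V) ∧ (∀ i j, B i j ∈ V) ∧ (∀ i j, C i j ∈ V) ∧ (∀ i j, D i j ∈ V)) ∧
      IsUnit D.det ∧ D * X = C ∧ M = A - B * X ∧ (s → Aᵀ = A ∧ C = Bᵀ ∧ Dᵀ = D)

variable {V : Submodule F K} {s : Prop} {κ μ : Type*}

theorem realizable_of_mem {M : Matrix κ κ K} (h : ∀ i j, M i j ∈ V) (hs : s → Mᵀ = M) :
    Realizable V s M :=
  ⟨Empty, inferInstance, inferInstance, M, 0, 0, 0, 0, ⟨h, by simp, by simp, by simp⟩, by simp,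
    by simp, by simp, fun h => ⟨hs h, by simp, by simp⟩⟩

theorem fromBlocks_mem {α β γ δ : Type*} {A : Matrix α γ K} {B : Matrix α δ K} {C : Matrix β γ K}
    {D : Matrix β δ K} (hA : ∀ i j, A i j ∈ V) (hB : ∀ i j, B i j ∈ V) (hC : ∀ i j, C i j ∈ V)
    (hD : ∀ i j, D i j ∈ V) (i j) : Matrix.fromBlocks A B C D i j ∈ V := by
  rcases i with i | i <;> rcases j with j | j <;> simp [*]

theorem fromRows_mem {α β γ : Type*} {A : Matrix α γ K} {B : Matrix β γ K}
    (hA : ∀ i j, A i j ∈ V) (hB : ∀ i j, B i j ∈ V) (i j) : Matrix.fromRows A B i j ∈ V := by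
  rcases i with i | i <;> simp [*]

theorem fromCols_mem {α β γ : Type*} {A : Matrix α β K} {B : Matrix α γ K}
    (hA : ∀ i j, A i j ∈ V) (hB : ∀ i j, B i j ∈ V) (i j) : Matrix.fromCols A B i j ∈ V := by
  rcases j with j | j <;> simp [*]

theorem Realizable.add {M N : Matrix κ κ K} (hM : Realizable V s M) (hN : Realizable V s N) :
    Realizable V s (M + N) := by
  obtain ⟨ι, _, _, A, B, C, D, X, ⟨hA, hB, hC, hD⟩, hu, hX, rfl, hs⟩ := hM
  obtain ⟨ι', _, _, A', B', C', D', X', ⟨hA', hB', hC', hD'⟩, hu', hX', rfl, hs'⟩ := hN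
  refine ⟨ι ⊕ ι', inferInstance, inferInstance, A + A', Matrix.fromCols B B', Matrix.fromRows C C',
    Matrix.fromBlocks D 0 0 D', Matrix.fromRows X X',
    ⟨fun i j => V.add_mem (hA i j) (hA' i j), fromCols_mem hB hB', fromRows_mem hC hC',
      fromBlocks_mem hD (by simp) (by simp) hD'⟩, ?_, ?_, ?_, fun h => ⟨?_, ?_, ?_⟩⟩
  · rw [Matrix.det_fromBlocks_zero₂₁]
    exact hu.mul hu'
  · simp [Matrix.fromBlocks_mul_fromRows, hX, hX']
  · rw [Matrix.fromCols_mul_fromRows]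
    abel
  · simp [hs h, hs' h]
  · rw [Matrix.transpose_fromCols, (hs h).2.1, (hs' h).2.1]
  · simp [Matrix.fromBlocks_transpose, hs h, hs' h]

theorem Realizable.zero : Realizable V s (0 : Matrix κ κ K) :=
  realizable_of_mem (by simp) (by simp)

theorem Realizable.sum {α : Type*} (S : Finset α) {M : α → Matrix κ κ K}
    (h : ∀ a ∈ S, Realizable V s (M a)) : Realizable V s (∑ a ∈ S, M a) := by
  classical
  induction S using Finset.induction_on with
  | empty => simpa using Realizable.zero
  | insert a S ha ih =>
    rw [Finset.sum_insert ha]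
    exact (h a (by simp)).add (ih fun b hb => h b (by simp [hb]))

theorem Realizable.smul {M : Matrix κ κ K} (hM : Realizable V s M) (c : F) :
    Realizable V s (c • M) := by
  -- The whole pencil is scaled, so `c • D` stays invertible only for `c ≠ 0`.
  rcases eq_or_ne c 0 with rfl | hc
  · rw [zero_smul]
    exact Realizable.zero
  obtain ⟨ι, _, _, A, B, C, D, X, ⟨hA, hB, hC, hD⟩, hu, hX, rfl, hs⟩ := hM
  refine ⟨ι, inferInstance, inferInstance, c • A, c • B, c • C, c • D, X,
    ⟨fun i j => V.smul_mem c (hA i j), fun i j => V.smul_mem c (hB i j),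
      fun i j => V.smul_mem c (hC i j), fun i j => V.smul_mem c (hD i j)⟩, ?_, ?_, ?_,
    fun h => ⟨?_, ?_, ?_⟩⟩
  · rw [Matrix.det_smul_of_tower, Algebra.smul_def]
    exact ((IsUnit.mk0 c hc).pow _ |>.map (algebraMap F K)).mul hu
  · rw [Matrix.smul_mul, hX]
  · rw [smul_sub, Matrix.smul_mul]
  · rw [Matrix.transpose_smul, (hs h).1]
  · rw [Matrix.transpose_smul, (hs h).2.1]
  · rw [Matrix.transpose_smul, (hs h).2.2]

theorem map_mul_mem {α β γ : Type*} [Fintype β] (P : Matrix α β F) {A : Matrix β γ K}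
    (hA : ∀ i j, A i j ∈ V) (i j) : (P.map (algebraMap F K) * A) i j ∈ V := by
  rw [Matrix.mul_apply]
  refine V.sum_mem fun b _ => ?_
  rw [Matrix.map_apply, ← Algebra.smul_def]
  exact V.smul_mem _ (hA b j)

theorem mul_map_mem {α β γ : Type*} [Fintype β] (P : Matrix β γ F) {A : Matrix α β K}
    (hA : ∀ i j, A i j ∈ V) (i j) : (A * P.map (algebraMap F K)) i j ∈ V := by
  rw [Matrix.mul_apply]
  refine V.sum_mem fun b _ => ?_
  rw [Matrix.map_apply, mul_comm, ← Algebra.smul_def]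
  exact V.smul_mem _ (hA i b)

theorem Realizable.map_mul_mul_map [Fintype κ] {M : Matrix κ κ K} (hM : Realizable V s M)
    (P : Matrix μ κ F) (Q : Matrix κ μ F) (hPQ : s → Q = Pᵀ) :
    Realizable V s (P.map (algebraMap F K) * M * Q.map (algebraMap F K)) := by
  obtain ⟨ι, _, _, A, B, C, D, X, ⟨hA, hB, hC, hD⟩, hu, hX, rfl, hs⟩ := hM
  refine ⟨ι, inferInstance, inferInstance, P.map (algebraMap F K) * A * Q.map (algebraMap F K),
    P.map (algebraMap F K) * B, C * Q.map (algebraMap F K), D, X * Q.map (algebraMap F K),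
    ⟨mul_map_mem _ (map_mul_mem _ hA), map_mul_mem _ hB, mul_map_mem _ hC, hD⟩, hu, ?_, ?_,
    fun h => ⟨?_, ?_, (hs h).2.2⟩⟩
  · rw [← Matrix.mul_assoc, hX]
  · simp only [Matrix.mul_sub, Matrix.sub_mul, Matrix.mul_assoc]
  · simp only [Matrix.transpose_mul, hPQ h, (hs h).1, Matrix.transpose_map, Matrix.mul_assoc,
      Matrix.transpose_transpose]
  · simp only [Matrix.transpose_mul, hPQ h, (hs h).2.1, Matrix.transpose_map]

/-- The eliminated block with `Dᵀ` and `D` off the diagonal is symmetric for any `D`, and its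
inverse produces `B D⁻¹ C` and its transpose together. The scalar sits on `C` and not on `D`, so `c
= 0` needs no separate case. -/
theorem Realizable.add_transpose_smul [Fintype κ] [DecidableEq κ] {M : Matrix κ κ K}
    (hM : Realizable V False M) (c : F) :
    Realizable V True (c • (M + Mᵀ)) := by
  obtain ⟨ι, _, _, A, B, C, D, X, ⟨hA, hB, hC, hD⟩, hu, hX, rfl, -⟩ := hM
  have huT : IsUnit Dᵀ.det := by rwa [Matrix.det_transpose]
  have hB' : Dᵀ * (Dᵀ⁻¹ * Bᵀ) = Bᵀ := by
    rw [← Matrix.mul_assoc, Matrix.mul_nonsing_inv _ huT, Matrix.one_mul]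
  have hXe : X = D⁻¹ * C := by
    rw [← hX, ← Matrix.mul_assoc, Matrix.nonsing_inv_mul _ hu, Matrix.one_mul]
  refine ⟨ι ⊕ ι, inferInstance, inferInstance, c • (A + Aᵀ), Matrix.fromCols B (c • Cᵀ),
    Matrix.fromRows Bᵀ (c • C), Matrix.fromBlocks 0 Dᵀ D 0,
    Matrix.fromRows (c • X) (Dᵀ⁻¹ * Bᵀ),
    ⟨fun i j => V.smul_mem _ (V.add_mem (hA i j) (hA j i)),
      fromCols_mem hB fun i j => V.smul_mem _ (hC j i),
      fromRows_mem (fun i j => hB j i) fun i j => V.smul_mem _ (hC i j),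
      fromBlocks_mem (by simp) (fun i j => hD j i) hD (by simp)⟩, ?_, ?_, ?_, fun h => ⟨?_, ?_, ?_⟩⟩
  · refine (Matrix.isUnit_iff_isUnit_det _).1 (IsUnit.of_mul_eq_one
      (Matrix.fromBlocks 0 D⁻¹ Dᵀ⁻¹ 0) ?_)
    simp [Matrix.fromBlocks_multiply, Matrix.mul_nonsing_inv _ hu, Matrix.mul_nonsing_inv _ huT]
  · simp [Matrix.fromBlocks_mul_fromRows, hX, hB']
  · rw [Matrix.fromCols_mul_fromRows, hXe]
    simp only [Matrix.transpose_sub, Matrix.transpose_mul, Matrix.transpose_nonsing_inv,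
      Matrix.mul_smul, Matrix.smul_mul, Matrix.mul_assoc, smul_add, smul_sub]
    abel
  · simp [add_comm]
  · simp [Matrix.transpose_fromCols]
  · simp [Matrix.fromBlocks_transpose]

/-- Quotient property of Schur complements: eliminating `ι` and then `μ` amounts to eliminating `μ ⊕
ι` at once. The determinant of the joint block is `det D * det N₂₂`, and back-substitution gives the
solution `(Y, X₁ - X₂ Y)`. -/
theorem Realizable.schur {μ : Type} [Fintype μ] [DecidableEq μ]
    {N₁₁ : Matrix κ κ K} {N₁₂ : Matrix κ μ K} {N₂₁ : Matrix μ κ K} {N₂₂ : Matrix μ μ K}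
    (hN : Realizable V s (Matrix.fromBlocks N₁₁ N₁₂ N₂₁ N₂₂)) (hu : IsUnit N₂₂.det)
    {Y : Matrix μ κ K} (hY : N₂₂ * Y = N₂₁) : Realizable V s (N₁₁ - N₁₂ * Y) := by
  obtain ⟨ι, _, _, A, B, C, D, X, ⟨hA, hB, hC, hD⟩, hDu, hX, hN, hs⟩ := hN
  obtain ⟨A₁₁, A₁₂, A₂₁, A₂₂, rfl⟩ : ∃ a b c d, A = Matrix.fromBlocks a b c d :=
    ⟨_, _, _, _, (Matrix.fromBlocks_toBlocks A).symm⟩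
  obtain ⟨B₁, B₂, rfl⟩ : ∃ a b, B = Matrix.fromRows a b := ⟨_, _, (Matrix.fromRows_toRows B).symm⟩
  obtain ⟨C₁, C₂, rfl⟩ : ∃ a b, C = Matrix.fromCols a b := ⟨_, _, (Matrix.fromCols_toCols C).symm⟩
  obtain ⟨X₁, X₂, rfl⟩ : ∃ a b, X = Matrix.fromCols a b := ⟨_, _, (Matrix.fromCols_toCols X).symm⟩
  rw [Matrix.mul_fromCols, Matrix.fromCols_inj.eq_iff] at hX
  rw [Matrix.fromRows_mul_fromCols, sub_eq_add_neg, Matrix.fromBlocks_neg, Matrix.fromBlocks_add,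
    Matrix.fromBlocks_inj] at hN
  obtain ⟨hX₁, hX₂⟩ := hX
  obtain ⟨rfl, rfl, rfl, rfl⟩ := hN
  have hX₂e : X₂ = D⁻¹ * C₂ := by
    rw [← hX₂, ← Matrix.mul_assoc, Matrix.nonsing_inv_mul _ hDu, Matrix.one_mul]
  refine ⟨μ ⊕ ι, inferInstance, inferInstance, A₁₁, Matrix.fromCols A₁₂ B₁,
    Matrix.fromRows A₂₁ C₁, Matrix.fromBlocks A₂₂ B₂ C₂ D, Matrix.fromRows Y (X₁ - X₂ * Y),
    ⟨fun i j => hA (.inl i) (.inl j),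
      fromCols_mem (fun i j => hA (.inl i) (.inr j)) fun i j => hB (.inl i) j,
      fromRows_mem (fun i j => hA (.inr i) (.inl j)) fun i j => hC i (.inl j),
      fromBlocks_mem (fun i j => hA (.inr i) (.inr j)) (fun i j => hB (.inr i) j)
        (fun i j => hC i (.inr j)) hD⟩, ?_, ?_, ?_, fun h => ?_⟩
  · let := D.invertibleOfIsUnitDet hDu
    rw [Matrix.det_fromBlocks₂₂, Matrix.invOf_eq_nonsing_inv, Matrix.mul_assoc, ← hX₂e,
      sub_eq_add_neg]
    exact hDu.mul hu
  · rw [Matrix.fromBlocks_mul_fromRows]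
    congr 1
    · rw [eq_add_neg_iff_add_eq, Matrix.add_mul, Matrix.neg_mul, Matrix.mul_assoc] at hY
      rw [← hY, Matrix.mul_sub]
      abel
    · rw [Matrix.mul_sub, ← Matrix.mul_assoc, hX₁, hX₂]
      abel
  · rw [Matrix.fromCols_mul_fromRows]
    simp only [Matrix.mul_sub, Matrix.add_mul, Matrix.neg_mul, Matrix.mul_assoc]
    abel
  · obtain ⟨h₁, h₂, h₃⟩ := hs h
    rw [Matrix.fromBlocks_transpose, Matrix.fromBlocks_inj] at h₁
    rw [Matrix.transpose_fromRows, Matrix.fromCols_inj.eq_iff] at h₂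
    exact ⟨h₁.1, by rw [Matrix.transpose_fromCols, h₁.2.2.1, h₂.1],
      by rw [Matrix.fromBlocks_transpose, h₁.2.2.2, h₂.2, h₃, Matrix.transpose_transpose]⟩

theorem Realizable.congr_matrix {M N : Matrix κ κ K} (hM : Realizable V s M) (h : M = N) :
    Realizable V s N := h ▸ hM

theorem realizable_single [Fintype κ] [DecidableEq κ] {f : K}
    (hf : Realizable V s (Matrix.of fun _ _ : Unit => f)) (i j : κ) (hs : s → i = j) :
    Realizable V s (Matrix.single i j f) := by
  refine (hf.map_mul_mul_map (Matrix.single i () (1 : F)) (Matrix.single () j (1 : F))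
    fun h => ?_).congr_matrix ?_
  · rw [hs h, Matrix.transpose_single]
  · ext a b
    by_cases ha : i = a <;> by_cases hb : j = b <;> simp [Matrix.mul_apply, ha, hb]

theorem realizable_of_entries [Fintype κ] [DecidableEq κ] {M : Matrix κ κ K}
    (h : ∀ i j, Realizable V False (Matrix.of fun _ _ : Unit => M i j)) : Realizable V False M := by
  rw [Matrix.matrix_eq_sum_single M]
  exact Realizable.sum _ fun i _ => Realizable.sum _ fun j _ =>
    realizable_single (h i j) i j False.elim

/-- The set of realizable scalars is closed under `(f, g, h) ↦ f g⁻¹ h`. -/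
theorem Realizable.mul_inv_mul {f g h : K} (hf : Realizable V False (Matrix.of fun _ _ : Unit => f))
    (hg : Realizable V False (Matrix.of fun _ _ : Unit => g))
    (hh : Realizable V False (Matrix.of fun _ _ : Unit => h)) (hg0 : g ≠ 0) :
    Realizable V False (Matrix.of fun _ _ : Unit => f * g⁻¹ * h) := by
  -- The Schur complement of `[0, f; h, -g]` is `f g⁻¹ h`.
  have hN : Realizable V False (Matrix.fromBlocks (Matrix.of fun _ _ : Unit => (0 : K))
      (Matrix.of fun _ _ : Unit => f) (Matrix.of fun _ _ : Unit => h)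
      (Matrix.of fun _ _ : Unit => -g)) := by
    refine realizable_of_entries fun i j => ?_
    rcases i with i | i <;> rcases j with j | j
    · exact Realizable.zero
    · exact hf
    · exact hh
    · refine (hg.map_mul_mul_map (-1) 1 False.elim).congr_matrix ?_
      ext
      simp [Matrix.mul_apply]
  refine (hN.schur (Y := Matrix.of fun _ _ : Unit => -(g⁻¹ * h)) (by simp [hg0]) ?_).congr_matrix ?_
  · ext
    simp [Matrix.mul_apply, hg0]
  · ext
    simp [Matrix.mul_apply, mul_assoc]

/-! ### The field of realizable ratios and sufficient conditions for realizability. -/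

variable {t : K}

/-- The subfield of ratios `r / t`, for `r` a realizable scalar. -/
def realizableField (V : Submodule F K) {t : K} (ht : t ∈ V) (ht0 : t ≠ 0) :
    IntermediateField F K where
  carrier := {a | Realizable V False (Matrix.of fun _ _ : Unit => t * a)}
  -- Products come from `(t a) t⁻¹ (t b) = t (a b)`, inverses below from `t (t a)⁻¹ t = t a⁻¹`.
  mul_mem' {a b} ha hb := (Realizable.mul_inv_mul ha (realizable_of_mem (M := .of fun _ _ => t)
    (fun _ _ => ht) False.elim) hb ht0).congr_matrix (by ext; simp; field_simp)
  add_mem' {a b} ha hb := (Realizable.add ha hb).congr_matrix (by ext; simp [mul_add])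
  algebraMap_mem' c := realizable_of_mem
    (fun _ _ => by simpa [Algebra.smul_def, mul_comm] using V.smul_mem c ht) False.elim
  inv_mem' a ha := by
    by_cases h : a = 0
    · exact Realizable.zero.congr_matrix (by ext; simp [h])
    · have hT := realizable_of_mem (V := V) (s := False) (M := .of fun _ _ : Unit => t)
        (fun _ _ => ht) False.elim
      exact (hT.mul_inv_mul ha hT (mul_ne_zero ht0 h)).congr_matrix
        (by ext; simp; field_simp)

theorem adjoin_le_realizableField (ht : t ∈ V) (ht0 : t ≠ 0) :
    IntermediateField.adjoin F {a | t * a ∈ V} ≤ realizableField V ht ht0 :=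
  IntermediateField.adjoin_le_iff.2 fun _ ha =>
    realizable_of_mem (fun _ _ => ha) False.elim

theorem realizable_false [Fintype κ] (ht : t ∈ V) (ht0 : t ≠ 0)
    {M : Matrix κ κ K} (h : ∀ i j, M i j / t ∈ IntermediateField.adjoin F {a | t * a ∈ V}) :
    Realizable V False M := by
  classical
  refine realizable_of_entries fun i j => ?_
  have := adjoin_le_realizableField ht ht0 (h i j)
  exact Realizable.congr_matrix this (by ext; simp; field_simp)

theorem realizable_true_of_two_ne_zero [Fintype κ] (h2 : (2 : F) ≠ 0)
    {M : Matrix κ κ K} (hM : Realizable V False M) (hs : Mᵀ = M) : Realizable V True M := by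
  classical
  refine (hM.add_transpose_smul (2⁻¹ : F)).congr_matrix ?_
  rw [hs, ← two_smul F M, smul_smul, inv_mul_cancel₀ h2, one_smul]

/-- `ℓ q²` is the Schur complement of `[0, 0, tq; 0, ℓ, -t; tq, -t, 0]` with respect to its lower
right 2 × 2 block `T`. The entries `tq` need not lie in `V`; being off the diagonal, they are
realized symmetrically as `U + Uᵀ`. -/
theorem realizable_mul_sq (ht : t ∈ V) (ht0 : t ≠ 0) {ℓ q : K} (hℓ : ℓ ∈ V)
    (hq : q ∈ IntermediateField.adjoin F {a | t * a ∈ V}) :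
    Realizable V True (Matrix.of fun _ _ : Unit => ℓ * q ^ 2) := by
  have hR : Realizable V False (.of fun _ _ : Unit => t * q) := adjoin_le_realizableField ht ht0 hq
  have hU : Realizable V False (Matrix.single (.inl ()) (.inr (.inr ())) (t * q) :
      Matrix (Unit ⊕ Unit ⊕ Unit) (Unit ⊕ Unit ⊕ Unit) K) := realizable_single hR _ _ False.elim
  let T : Matrix (Unit ⊕ Unit) (Unit ⊕ Unit) K :=
    Matrix.fromBlocks (.of fun _ _ => ℓ) (.of fun _ _ => -t) (.of fun _ _ => -t) 0
  have hT : Realizable V True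
      (Matrix.fromBlocks 0 0 0 T : Matrix (Unit ⊕ Unit ⊕ Unit) (Unit ⊕ Unit ⊕ Unit) K) := by
    refine realizable_of_mem (fromBlocks_mem (by simp) (by simp) (by simp)
      (fromBlocks_mem (by simp [hℓ]) (by simp [ht]) (by simp [ht]) (by simp))) fun _ => ?_
    simp only [T, Matrix.fromBlocks_transpose]
    rfl
  have hN : Realizable V True (Matrix.fromBlocks 0
      (Matrix.fromCols 0 (.of fun _ _ : Unit => t * q))
      (Matrix.fromRows 0 (.of fun _ _ : Unit => t * q)) T) := by
    refine ((hU.add_transpose_smul (1 : F)).add hT).congr_matrix ?_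
    ext (i | i | i) (j | j | j) <;> simp
  refine (hN.schur (Y := Matrix.fromRows (.of fun _ _ : Unit => -q)
    (.of fun _ _ : Unit => -(ℓ * q / t))) ?_ ?_).congr_matrix ?_
  · refine (Matrix.isUnit_iff_isUnit_det _).1 (IsUnit.of_mul_eq_one (Matrix.fromBlocks 0
      (.of fun _ _ => -t⁻¹) (.of fun _ _ => -t⁻¹) (.of fun _ _ => -(ℓ / t ^ 2))) ?_)
    simp only [T, Matrix.fromBlocks_multiply, ← Matrix.fromBlocks_one, Matrix.fromBlocks_inj]
    refine ⟨?_, ?_, ?_, ?_⟩ <;> (ext; simp [Matrix.mul_apply, ht0]; try (field_simp; ring))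
  · simp only [T, Matrix.fromBlocks_mul_fromRows]
    congr 1 <;> (ext; simp [Matrix.mul_apply]; try (field_simp; ring))
  · rw [Matrix.fromCols_mul_fromRows]
    ext
    simp [Matrix.mul_apply]
    field_simp

/-- The span of the products `ℓ q²` with `ℓ ∈ V` and `q` in the field generated by `V / t`. -/
def weightedSquareSpan (V : Submodule F K) (t : K) : Submodule F K :=
  Submodule.span F {r | ∃ ℓ ∈ V, ∃ q ∈ IntermediateField.adjoin F {a | t * a ∈ V}, r = ℓ * q ^ 2}

/-- With `U` the strict upper triangle, `M` is `U + Uᵀ` plus its diagonal, in every characteristic;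
only the diagonal entries need the span condition. -/
theorem realizable_true_of_diag_mem_span [Fintype κ] [LinearOrder κ] (ht : t ∈ V) (ht0 : t ≠ 0)
    {M : Matrix κ κ K} (h : ∀ i j, M i j / t ∈ IntermediateField.adjoin F {a | t * a ∈ V})
    (hs : Mᵀ = M) (hd : ∀ i, M i i ∈ weightedSquareSpan V t) :
    Realizable V True M := by
  have hU : Realizable V False (Matrix.of fun i j => if i < j then M i j else 0) := by
    refine realizable_false ht ht0 fun i j => ?_
    by_cases hij : i < j
    · simpa [hij] using h i j
    · simp [hij]
  have hD (i : κ) : Realizable V True (Matrix.of fun _ _ : Unit => M i i) := by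
    refine Submodule.span_induction (p := fun x _ => Realizable V True (.of fun _ _ : Unit => x))
      ?_ Realizable.zero (fun x y _ _ hx hy => hx.add hy) (fun c x _ hx => ?_) (hd i)
    · rintro _ ⟨ℓ, hℓ, q, hq, rfl⟩
      exact realizable_mul_sq ht ht0 hℓ hq
    · exact (hx.smul c).congr_matrix (by ext; simp)
  refine ((hU.add_transpose_smul (1 : F)).add (Realizable.sum Finset.univ
    (M := fun i => Matrix.single i i (M i i))
    fun i _ => realizable_single (hD i) i i fun _ => rfl)).congr_matrix ?_
  ext i j
  rw [Matrix.sum_single_eq_diagonal]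
  rcases lt_trichotomy i j with hij | rfl | hij
  · simp [hij, hij.not_gt, hij.ne]
  · simp
  · simpa [hij, hij.not_gt, hij.ne'] using congr_fun₂ hs i j

/-- With two spanning elements the generated field is `F(x)`, `x = u / t`. Any `f = t r(x) / s(x)`
equals `t (r s)(x) / s(x)²`, whose monomials are weighted squares: even powers of `x` carry the
weight `t`, odd ones the weight `t x = u`. -/
theorem mem_weightedSquareSpan_of_pair (ht0 : t ≠ 0) (ht : t ∈ V) {u : K} (hu : u ∈ V)
    (hV : V ≤ Submodule.span F {t, u}) {f : K}
    (hf : f / t ∈ IntermediateField.adjoin F {a | t * a ∈ V}) : f ∈ weightedSquareSpan V t := by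
  have hx : u / t ∈ IntermediateField.adjoin F {a | t * a ∈ V} :=
    IntermediateField.subset_adjoin _ _ (by simpa [mul_div_cancel₀ _ ht0] using hu)
  have hle : IntermediateField.adjoin F {a | t * a ∈ V} ≤ IntermediateField.adjoin F {u / t} := by
    refine IntermediateField.adjoin_le_iff.2 fun a ha => ?_
    obtain ⟨c, d, hcd⟩ := Submodule.mem_span_pair.1 (hV ha)
    have : a = algebraMap F K c + d • (u / t) := by
      rw [Algebra.smul_def] at hcd ⊢
      rw [Algebra.smul_def] at hcd
      field_simp
      linear_combination -hcd
    rw [this]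
    exact add_mem (algebraMap_mem _ c)
      (IntermediateField.smul_mem _ (IntermediateField.mem_adjoin_simple_self F (u / t)))
  obtain ⟨r, s, hrs⟩ := IntermediateField.mem_adjoin_simple_iff F _ |>.1 (hle hf)
  have hS (p : Polynomial F) : Polynomial.aeval (u / t) p ∈
      IntermediateField.adjoin F {a | t * a ∈ V} := by
    rw [Polynomial.aeval_eq_sum_range]
    exact sum_mem fun i _ => IntermediateField.smul_mem _ (pow_mem hx i)
  set w := Polynomial.aeval (u / t) s with hw
  have hf' : f = ∑ i ∈ Finset.range ((r * s).natDegree + 1),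
      (r * s).coeff i • (t * (u / t) ^ i * (w⁻¹) ^ 2) := by
    have h1 : f = t * Polynomial.aeval (u / t) (r * s) * w⁻¹ ^ 2 := by
      rw [div_eq_iff ht0] at hrs
      rw [hrs, map_mul, ← hw]
      rcases eq_or_ne w 0 with h | h
      · simp [h]
      · field_simp
    rw [h1, Polynomial.aeval_eq_sum_range, Finset.mul_sum, Finset.sum_mul]
    exact Finset.sum_congr rfl fun i _ => by rw [mul_smul_comm, smul_mul_assoc]
  rw [hf']
  refine Submodule.sum_mem _ fun i _ => Submodule.smul_mem _ _ (Submodule.subset_span ?_)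
  rcases Nat.even_or_odd' i with ⟨j, rfl | rfl⟩
  · exact ⟨t, ht, (u / t) ^ j * w⁻¹, mul_mem (pow_mem hx j) (inv_mem (hS s)), by ring⟩
  · exact ⟨u, hu, (u / t) ^ j * w⁻¹, mul_mem (pow_mem hx j) (inv_mem (hS s)), by
      have key : t * (u / t) = u := mul_div_cancel₀ u ht0
      generalize u / t = x at key ⊢
      linear_combination (x ^ (2 * j) * w⁻¹ ^ 2) * key⟩

/-! ### Constraints forced by a symmetric realization. -/

theorem sum_sum_eq_sum_diag_of_charTwo [CharP K 2] {ι : Type*} [Fintype ι] (g : ι → ι → K)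
    (hg : ∀ a b, g a b = g b a) : ∑ a, ∑ b, g a b = ∑ a, g a a := by
  classical
  rw [← Finset.sum_product', ← Finset.diag_union_offDiag,
    Finset.sum_union (Finset.disjoint_diag_offDiag _), Finset.sum_diag, add_eq_left]
  refine Finset.sum_involution (fun p _ => p.swap) (fun p _ => ?_) (fun p hp _ h => ?_)
    (fun p hp => ?_) (fun p _ => p.swap_swap)
  · rw [Prod.fst_swap, Prod.snd_swap, hg p.2 p.1, CharTwo.add_self_eq_zero]
  · exact (Finset.mem_offDiag.1 hp).2.2 (congrArg Prod.snd h)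
  · simpa [eq_comm] using hp

/-- Symmetry turns `B X` into `Xᵀ D X`, a quadratic form on each column of `X`; its cross terms
occur in equal pairs. -/
theorem apply_diag_of_charTwo [CharP K 2] {ι : Type*} [Fintype ι] {A : Matrix κ κ K}
    {B : Matrix κ ι K} {C : Matrix ι κ K} {D : Matrix ι ι K} {X : Matrix ι κ K}
    (hX : D * X = C) (hC : C = Bᵀ) (hD : Dᵀ = D) (i : κ) :
    (A - B * X) i i = A i i - ∑ a, D a a * X a i ^ 2 := by
  have hB : B = Xᵀ * D := by
    rw [← Matrix.transpose_transpose B, ← hC, ← hX, Matrix.transpose_mul, hD]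
  rw [hB, Matrix.sub_apply, Matrix.mul_apply]
  simp only [Matrix.mul_apply, Finset.sum_mul, Matrix.transpose_apply]
  rw [sum_sum_eq_sum_diag_of_charTwo]
  · exact congrArg _ (Finset.sum_congr rfl fun a _ => by ring)
  · intro a b
    rw [← congr_fun₂ hD a b, Matrix.transpose_apply]
    ring

theorem Realizable.transpose_eq {M : Matrix κ κ K} (hM : Realizable V True M) : Mᵀ = M := by
  obtain ⟨ι, _, _, A, B, C, D, X, -, -, hX, rfl, hs⟩ := hM
  obtain ⟨hA, hC, hD⟩ := hs trivial
  have hB : B = Xᵀ * D := by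
    rw [← Matrix.transpose_transpose B, ← hC, ← hX, Matrix.transpose_mul, hD]
  simp only [hB, Matrix.transpose_sub, Matrix.transpose_mul, hA, hD, Matrix.transpose_transpose,
    Matrix.mul_assoc]

end Abstract

/-! ### Arithmetic of homogeneous rational functions. -/

section HomogeneousRat

variable {F : Type*} [Field F] {n : ℕ}

theorem algebraMap_ne_zero {q : MvPolynomial (Fin n) F} (hq : q ≠ 0) :
    algebraMap (MvPolynomial (Fin n) F) (RationalField F n) q ≠ 0 := by
  simpa using hq

theorem indet_ne_zero (i : Fin n) : indet F i ≠ 0 :=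
  algebraMap_ne_zero (MvPolynomial.X_ne_zero i)

namespace IsHomogeneousRat

variable {d e : ℤ} {r s : RationalField F n}

theorem of_isHomogeneous {a : ℕ} {p : MvPolynomial (Fin n) F} (hp : p.IsHomogeneous a) :
    IsHomogeneousRat a (algebraMap _ (RationalField F n) p) :=
  ⟨a, 0, p, 1, hp, MvPolynomial.isHomogeneous_one _ _, one_ne_zero, by simp, by simp⟩

theorem zero (d : ℕ) : IsHomogeneousRat d (0 : RationalField F n) := by
  simpa using of_isHomogeneous (MvPolynomial.isHomogeneous_zero (Fin n) F d)

theorem of_indet (i : Fin n) : IsHomogeneousRat 1 (indet F i) :=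
  of_isHomogeneous (MvPolynomial.isHomogeneous_X F i)

theorem const (c : F) : IsHomogeneousRat 0 (algebraMap F (RationalField F n) c) := by
  rw [IsScalarTower.algebraMap_apply F (MvPolynomial (Fin n) F)]
  exact of_isHomogeneous (MvPolynomial.isHomogeneous_C _ c)

theorem one : IsHomogeneousRat 0 (1 : RationalField F n) := by
  simpa using const (n := n) (1 : F)

theorem add (hr : IsHomogeneousRat d r) (hs : IsHomogeneousRat d s) :
    IsHomogeneousRat d (r + s) := by
  obtain ⟨a, b, p, q, hp, hq, hq0, hd, rfl⟩ := hr
  obtain ⟨a', b', p', q', hp', hq', hq0', hd', rfl⟩ := hs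
  refine ⟨a + b', b + b', p * q' + q * p', q * q', (hp.mul hq').add ?_, hq.mul hq',
    mul_ne_zero hq0 hq0', by push_cast; linarith, ?_⟩
  · obtain h : a + b' = b + a' := by zify; linarith
    exact h ▸ hq.mul hp'
  · rw [div_add_div _ _ (algebraMap_ne_zero hq0) (algebraMap_ne_zero hq0')]
    simp only [map_add, map_mul]

theorem mul (hr : IsHomogeneousRat d r) (hs : IsHomogeneousRat e s) :
    IsHomogeneousRat (d + e) (r * s) := by
  obtain ⟨a, b, p, q, hp, hq, hq0, hd, rfl⟩ := hr
  obtain ⟨a', b', p', q', hp', hq', hq0', hd', rfl⟩ := hs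
  exact ⟨a + a', b + b', p * p', q * q', hp.mul hp', hq.mul hq', mul_ne_zero hq0 hq0',
    by push_cast; linarith, by rw [div_mul_div_comm, map_mul, map_mul]⟩

theorem inv (hr : IsHomogeneousRat d r) (h0 : r ≠ 0) : IsHomogeneousRat (-d) r⁻¹ := by
  obtain ⟨a, b, p, q, hp, hq, hq0, hd, rfl⟩ := hr
  exact ⟨b, a, q, p, hq, hp, fun h => h0 (by simp [h]), by linarith, inv_div _ _⟩

theorem smul (hr : IsHomogeneousRat d r) (c : F) : IsHomogeneousRat d (c • r) := by
  rw [Algebra.smul_def, ← zero_add d]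
  exact (const c).mul hr

theorem neg (hr : IsHomogeneousRat d r) : IsHomogeneousRat d (-r) := by
  simpa using hr.smul (-1)

theorem sub (hr : IsHomogeneousRat d r) (hs : IsHomogeneousRat d s) :
    IsHomogeneousRat d (r - s) := by
  rw [sub_eq_add_neg]
  exact hr.add hs.neg

theorem sum {d : ℕ} {α : Type*} (S : Finset α) {f : α → RationalField F n}
    (h : ∀ a ∈ S, IsHomogeneousRat d (f a)) : IsHomogeneousRat d (∑ a ∈ S, f a) :=
  Finset.sum_induction _ _ (fun _ _ => add) (zero d) h

theorem prod {α : Type*} (S : Finset α) {d : α → ℤ} {f : α → RationalField F n}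
    (h : ∀ a ∈ S, IsHomogeneousRat (d a) (f a)) :
    IsHomogeneousRat (∑ a ∈ S, d a) (∏ a ∈ S, f a) := by
  classical
  induction S using Finset.induction_on with
  | empty => simpa using one
  | insert a S ha ih =>
    rw [Finset.sum_insert ha, Finset.prod_insert ha]
    exact (h a (by simp)).mul (ih fun b hb => h b (by simp [hb]))

/-- The degree may vary with the row because an adjugate entry is a determinant with one row
replaced by a constant unit vector. -/
theorem det {ι : Type*} [Fintype ι] [DecidableEq ι] {N : Matrix ι ι (RationalField F n)}
    (d : ι → ℕ) (h : ∀ i j, IsHomogeneousRat (d i) (N i j)) :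
    IsHomogeneousRat (∑ i, d i : ℕ) N.det := by
  rw [Matrix.det_apply]
  refine sum _ fun σ _ => ?_
  have hp : IsHomogeneousRat (∑ i, d i : ℕ) (∏ i, N (σ i) i) := by
    rw [← Equiv.sum_comp σ, Nat.cast_sum]
    exact prod _ fun i _ => h _ _
  rcases Int.units_eq_one_or (Equiv.Perm.sign σ) with hσ | hσ
  · simpa [hσ] using hp
  · simpa [hσ] using hp.neg

theorem inv_apply {ι : Type*} [Fintype ι] [DecidableEq ι] {N : Matrix ι ι (RationalField F n)}
    (h : ∀ i j, IsHomogeneousRat 1 (N i j)) (hN : IsUnit N.det) (i j : ι) :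
    IsHomogeneousRat (-1) (N⁻¹ i j) := by
  have hdet := det (fun _ => 1) (by simpa using h)
  -- Row `j` is the constant one, so the degree is one less than that of `N.det`.
  have hadj : IsHomogeneousRat (∑ a, Function.update (fun _ => 1) j 0 a : ℕ) (N.adjugate i j) := by
    rw [Matrix.adjugate_apply]
    refine det _ fun a b => ?_
    rcases eq_or_ne a j with rfl | ha
    · rcases eq_or_ne b i with rfl | hb
      · simpa using one
      · simpa [hb] using zero 0
    · simpa [ha] using h a b
  rw [Matrix.inv_def, Ring.inverse_eq_inv', Matrix.smul_apply, smul_eq_mul]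
  convert (hdet.inv hN.ne_zero).mul hadj using 1
  rw [Finset.sum_update_of_mem (Finset.mem_univ j), ← Finset.sum_sdiff
    (Finset.subset_univ ({j} : Finset ι))]
  simp

theorem of_mem_linearForms {f : RationalField F n}
    (hf : f ∈ Submodule.span F (Set.range (indet F (n := n)))) :
    IsHomogeneousRat 1 f :=
  Submodule.span_induction (p := fun f _ => IsHomogeneousRat 1 f)
    (by rintro _ ⟨i, rfl⟩; exact of_indet i) (zero 1) (fun _ _ _ _ => add)
    (fun c _ _ h => h.smul c) hf

end IsHomogeneousRat

end HomogeneousRat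

/-! ### Linear and affine forms, their ratios and weighted squares. -/

section Forms

variable (F : Type*) [Field F] (n : ℕ)

/-- The space spanned by `z_1, …, z_n`. -/
def linearForms : Submodule F (RationalField F n) :=
  Submodule.span F (Set.range (indet F))

/-- The space spanned by `1, z_1, …, z_n`. -/
def affineForms : Submodule F (RationalField F n) :=
  Submodule.span F (insert 1 (Set.range (indet F)))

variable {F n}

theorem indet_mem_linearForms (i : Fin n) : indet F i ∈ linearForms F n :=
  Submodule.subset_span ⟨i, rfl⟩

theorem one_mem_affineForms : (1 : RationalField F n) ∈ affineForms F n :=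
  Submodule.subset_span (Set.mem_insert _ _)

theorem linearForms_le_affineForms : linearForms F n ≤ affineForms F n :=
  Submodule.span_mono (Set.subset_insert _ _)

theorem mem_adjoin_affineForms (f : RationalField F n) :
    f ∈ IntermediateField.adjoin F {a | 1 * a ∈ affineForms F n} := by
  have hp (p : MvPolynomial (Fin n) F) : algebraMap _ (RationalField F n) p ∈
      IntermediateField.adjoin F {a | 1 * a ∈ affineForms F n} := by
    induction p using MvPolynomial.induction_on with
    | C c =>
      rw [← MvPolynomial.algebraMap_eq, ← IsScalarTower.algebraMap_apply]
      exact algebraMap_mem _ c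
    | add p q hp hq => rw [map_add]; exact add_mem hp hq
    | mul_X p i hp =>
      rw [map_mul]
      refine mul_mem hp (IntermediateField.subset_adjoin _ _ ?_)
      rw [Set.mem_ofPred_eq, one_mul]
      exact linearForms_le_affineForms (indet_mem_linearForms i)
  obtain ⟨p, q, -, rfl⟩ := IsFractionRing.div_surjective (A := MvPolynomial (Fin n) F) f
  exact div_mem (hp p) (hp q)

/-- Dehomogenization: dividing by `z_{i₀}^a` turns each monomial of degree `a` into a product of
ratios `z_i / z_{i₀}`. -/
theorem algebraMap_div_pow_mem_adjoin {i₀ : Fin n} {p : MvPolynomial (Fin n) F} {a : ℕ}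
    (hp : p.IsHomogeneous a) : algebraMap _ (RationalField F n) p / indet F i₀ ^ a ∈
      IntermediateField.adjoin F {a | indet F i₀ * a ∈ linearForms F n} := by
  rw [p.as_sum, map_sum, Finset.sum_div]
  refine sum_mem fun m hm => ?_
  have hm' : ∑ i, m i = a := by
    rw [← hp (MvPolynomial.mem_support_iff.1 hm), Finsupp.weight_apply,
      Finsupp.sum_fintype _ _ (by simp)]
    simp
  have h : algebraMap _ (RationalField F n) (MvPolynomial.monomial m (p.coeff m)) / indet F i₀ ^ a =
      p.coeff m • ∏ i, (indet F i / indet F i₀) ^ m i := by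
    rw [MvPolynomial.monomial_eq, Finsupp.prod_fintype _ _ (by simp), map_mul, map_prod,
      ← MvPolynomial.algebraMap_eq, ← IsScalarTower.algebraMap_apply, Algebra.smul_def,
      mul_div_assoc]
    simp only [div_pow, Finset.prod_div_distrib, Finset.prod_pow_eq_pow_sum, hm', map_pow]
    rfl
  rw [h]
  refine IntermediateField.smul_mem _ (prod_mem fun i _ => pow_mem
    (IntermediateField.subset_adjoin _ _ ?_) _)
  rw [Set.mem_ofPred_eq, mul_div_cancel₀ _ (indet_ne_zero i₀)]
  exact indet_mem_linearForms i

theorem IsHomogeneousRat.div_pow_mem_adjoin {f : RationalField F n} {d : ℕ}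
    (hf : IsHomogeneousRat d f) (i₀ : Fin n) : f / indet F i₀ ^ d ∈
      IntermediateField.adjoin F {a | indet F i₀ * a ∈ linearForms F n} := by
  obtain ⟨a, b, p, q, hp, hq, hq0, hd, rfl⟩ := hf
  obtain rfl : a = b + d := by exact_mod_cast hd
  have h := div_mem (algebraMap_div_pow_mem_adjoin (i₀ := i₀) hp)
    (algebraMap_div_pow_mem_adjoin (i₀ := i₀) hq)
  have h0 := indet_ne_zero (F := F) i₀
  have hq1 := algebraMap_ne_zero hq0
  convert h using 1
  rw [pow_add]
  field_simp

theorem affineForms_mul_sq_mem_squareSpan {ℓ : RationalField F n} (hℓ : ℓ ∈ affineForms F n)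
    (q : RationalField F n) : ℓ * q ^ 2 ∈ squareSpan F n := by
  refine Submodule.span_induction (p := fun ℓ _ => ℓ * q ^ 2 ∈ squareSpan F n) ?_ (by simp)
    (fun _ _ _ _ h₁ h₂ => by rw [add_mul]; exact add_mem h₁ h₂)
    (fun c _ _ h => by rw [smul_mul_assoc]; exact Submodule.smul_mem _ c h) hℓ
  rintro _ (rfl | ⟨i, rfl⟩)
  · exact Submodule.subset_span ⟨q, 0, by simp⟩
  · exact Submodule.subset_span ⟨0, Pi.single i q, by simp [Pi.single_apply, ite_pow]⟩

theorem linearForms_mul_sq_mem_homogeneousSquareSpan {ℓ : RationalField F n}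
    (hℓ : ℓ ∈ linearForms F n) {q : RationalField F n} (hq : IsHomogeneousRat 0 q) :
    ℓ * q ^ 2 ∈ homogeneousSquareSpan F n := by
  refine Submodule.span_induction (p := fun ℓ _ => ℓ * q ^ 2 ∈ homogeneousSquareSpan F n) ?_
    (by simp) (fun _ _ _ _ h₁ h₂ => by rw [add_mul]; exact add_mem h₁ h₂)
    (fun c _ _ h => by rw [smul_mul_assoc]; exact Submodule.smul_mem _ c h) hℓ
  rintro _ ⟨i, rfl⟩
  refine Submodule.subset_span ⟨Pi.single i q, fun j => ?_, by simp [Pi.single_apply, ite_pow]⟩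
  rcases eq_or_ne j i with rfl | hj
  · simpa using hq
  · simpa [hj] using IsHomogeneousRat.zero (F := F) (n := n) 0

theorem squareSpan_le : squareSpan F n ≤ weightedSquareSpan (affineForms F n) 1 := by
  refine Submodule.span_le.2 ?_
  rintro _ ⟨q₀, q, rfl⟩
  refine add_mem (Submodule.subset_span ⟨1, one_mem_affineForms, q₀, mem_adjoin_affineForms _,
    by simp⟩) (sum_mem fun i _ => Submodule.subset_span ⟨indet F i,
      linearForms_le_affineForms (indet_mem_linearForms i), q i, mem_adjoin_affineForms _, rfl⟩)

theorem homogeneousSquareSpan_le (i₀ : Fin n) :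
    homogeneousSquareSpan F n ≤ weightedSquareSpan (linearForms F n) (indet F i₀) := by
  refine Submodule.span_le.2 ?_
  rintro _ ⟨q, hq, rfl⟩
  refine sum_mem fun i _ => Submodule.subset_span ⟨indet F i, indet_mem_linearForms i, q i, ?_, rfl⟩
  simpa using IsHomogeneousRat.div_pow_mem_adjoin (d := 0) (hq i) i₀

end Forms

/-! ### Necessary conditions for homogeneous and for symmetric realizations. -/

section Necessity

variable {F : Type*} [Field F] {n : ℕ} {κ : Type*} {s : Prop}
  {M : Matrix κ κ (RationalField F n)}

theorem isHomogeneousRat_zero_of_mul_eq {ι : Type*} [Fintype ι] [DecidableEq ι]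
    {D : Matrix ι ι (RationalField F n)} {X C : Matrix ι κ (RationalField F n)}
    (hD : ∀ i j, D i j ∈ linearForms F n) (hC : ∀ i j, C i j ∈ linearForms F n)
    (hu : IsUnit D.det) (h : D * X = C) (i : ι) (j : κ) : IsHomogeneousRat 0 (X i j) := by
  have : X = D⁻¹ * C := by
    rw [← h, ← Matrix.mul_assoc, Matrix.nonsing_inv_mul _ hu, Matrix.one_mul]
  rw [this, Matrix.mul_apply]
  refine IsHomogeneousRat.sum (d := 0) _ fun a _ => ?_
  exact (IsHomogeneousRat.inv_apply (fun i j => .of_mem_linearForms (hD i j)) hu i a).mul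
    (.of_mem_linearForms (hC a j))

theorem Realizable.isHomogeneousRat (hM : Realizable (linearForms F n) s M) (i j : κ) :
    IsHomogeneousRat 1 (M i j) := by
  obtain ⟨ι, _, _, A, B, C, D, X, ⟨hA, hB, hC, hD⟩, hu, hX, rfl, -⟩ := hM
  rw [Matrix.sub_apply, Matrix.mul_apply]
  refine (IsHomogeneousRat.of_mem_linearForms (hA i j)).sub
    (IsHomogeneousRat.sum (d := 1) _ fun a _ => ?_)
  exact (IsHomogeneousRat.of_mem_linearForms (hB i a)).mul
    (isHomogeneousRat_zero_of_mul_eq hD hC hu hX a j)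

theorem Realizable.diag_mem_squareSpan [CharP F 2] (hM : Realizable (affineForms F n) True M)
    (i : κ) : M i i ∈ squareSpan F n := by
  have := charP_of_injective_algebraMap (algebraMap F (RationalField F n)).injective 2
  obtain ⟨ι, _, _, A, B, C, D, X, ⟨hA, hB, hC, hD⟩, hu, hX, rfl, hs⟩ := hM
  rw [apply_diag_of_charTwo hX (hs trivial).2.1 (hs trivial).2.2]
  refine sub_mem ?_ (sum_mem fun a _ => affineForms_mul_sq_mem_squareSpan (hD a a) _)
  simpa using affineForms_mul_sq_mem_squareSpan (hA i i) 1

theorem Realizable.diag_mem_homogeneousSquareSpan [CharP F 2]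
    (hM : Realizable (linearForms F n) True M) (i : κ) : M i i ∈ homogeneousSquareSpan F n := by
  have := charP_of_injective_algebraMap (algebraMap F (RationalField F n)).injective 2
  obtain ⟨ι, _, _, A, B, C, D, X, ⟨hA, hB, hC, hD⟩, hu, hX, rfl, hs⟩ := hM
  rw [apply_diag_of_charTwo hX (hs trivial).2.1 (hs trivial).2.2]
  refine sub_mem ?_ (sum_mem fun a _ => linearForms_mul_sq_mem_homogeneousSquareSpan (hD a a)
    (isHomogeneousRat_zero_of_mul_eq hD hC hu hX a i))
  simpa using linearForms_mul_sq_mem_homogeneousSquareSpan (hA i i) .one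

end Necessity

/-! ### Passage between pencils and matrices of forms. -/

section Pencils

variable {F : Type*} [Field F] {n k : ℕ} {ι : Type*} {s : Prop}

theorem LinearPencil.toMatrix_apply (A : LinearPencil F n ι) (i j : ι) :
    A.toMatrix i j = algebraMap F _ (A.const i j) + ∑ m, A.coeff m i j • indet F m := by
  simp only [toMatrix, toPolyMatrix, Matrix.map_apply, Matrix.add_apply, Matrix.sum_apply,
    Matrix.smul_apply, map_add, map_sum, smul_eq_mul, map_mul, ← MvPolynomial.algebraMap_eq,
    ← IsScalarTower.algebraMap_apply, Algebra.smul_def, mul_comm, indet]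

theorem LinearPencil.toMatrix_mem_affineForms (A : LinearPencil F n ι) (i j : ι) :
    A.toMatrix i j ∈ affineForms F n := by
  rw [toMatrix_apply, Algebra.algebraMap_eq_smul_one]
  exact add_mem (Submodule.smul_mem _ _ one_mem_affineForms)
    (sum_mem fun m _ => Submodule.smul_mem _ _
      (linearForms_le_affineForms (indet_mem_linearForms m)))

theorem LinearPencil.IsHomogeneous.toMatrix_mem_linearForms {A : LinearPencil F n ι}
    (hA : A.IsHomogeneous) (i j : ι) : A.toMatrix i j ∈ linearForms F n := by
  rw [toMatrix_apply, show A.const = 0 from hA, Matrix.zero_apply, map_zero, zero_add]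
  exact sum_mem fun m _ => Submodule.smul_mem _ _ (indet_mem_linearForms m)

theorem LinearPencil.IsSymmetric.toMatrix_transpose {A : LinearPencil F n ι}
    (hA : A.IsSymmetric) : A.toMatrixᵀ = A.toMatrix := by
  ext i j
  rw [Matrix.transpose_apply, toMatrix_apply, toMatrix_apply, ← congr_fun₂ hA.1 i j]
  simp only [Matrix.transpose_apply, ← fun m => congr_fun₂ (hA.2 m) i j]

theorem exists_homogeneous_pencil {N : Matrix ι ι (RationalField F n)}
    (hN : ∀ i j, N i j ∈ linearForms F n) :
    ∃ A : LinearPencil F n ι, A.toMatrix = N ∧ A.IsHomogeneous ∧ (Nᵀ = N → A.IsSymmetric) := by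
  -- Coefficients are chosen per function `f`, not per position, so equal entries get equal
  -- coefficients and symmetry passes to the pencil.
  have hc (f : RationalField F n) : ∃ c : Fin n → F,
      f ∈ linearForms F n → ∑ m, c m • indet F m = f := by
    by_cases hf : f ∈ linearForms F n
    · obtain ⟨c, hc⟩ := (Submodule.mem_span_range_iff_exists_fun F).1 hf
      exact ⟨c, fun _ => hc⟩
    · exact ⟨0, fun h => absurd h hf⟩
  choose c hc using hc
  refine ⟨⟨0, fun m => .of fun i j => c (N i j) m⟩, ?_, rfl, fun h => ⟨Matrix.transpose_zero, ?_⟩⟩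
  · ext i j
    simp [LinearPencil.toMatrix_apply, hc _ (hN i j)]
  · intro m
    ext i j
    simp [← congr_fun₂ h i j]

theorem exists_pencil {N : Matrix ι ι (RationalField F n)}
    (hN : ∀ i j, N i j ∈ affineForms F n) :
    ∃ A : LinearPencil F n ι, A.toMatrix = N ∧ (Nᵀ = N → A.IsSymmetric) := by
  have hc (f : RationalField F n) : ∃ (c₀ : F) (c : Fin n → F),
      f ∈ affineForms F n → algebraMap F _ c₀ + ∑ m, c m • indet F m = f := by
    by_cases hf : f ∈ affineForms F n
    · obtain ⟨c₀, g, hg, rfl⟩ := Submodule.mem_span_insert.1 hf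
      obtain ⟨c, rfl⟩ := (Submodule.mem_span_range_iff_exists_fun F).1 hg
      exact ⟨c₀, c, fun _ => by rw [Algebra.algebraMap_eq_smul_one]⟩
    · exact ⟨0, 0, fun h => absurd h hf⟩
  choose c₀ c hc using hc
  refine ⟨⟨.of fun i j => c₀ (N i j), fun m => .of fun i j => c (N i j) m⟩, ?_, fun h => ⟨?_, ?_⟩⟩
  · ext i j
    simp [LinearPencil.toMatrix_apply, hc _ (hN i j)]
  · ext i j
    simp [← congr_fun₂ h i j]
  · intro m
    ext i j
    simp [← congr_fun₂ h i j]

variable {K : Type*} [Field K] [Algebra F K] {V : Submodule F K}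

theorem realizable_schurComplement {l : ℕ} {N : Matrix (Fin k ⊕ Fin l) (Fin k ⊕ Fin l) K}
    (hN : ∀ i j, N i j ∈ V) (hs : s → Nᵀ = N) (hu : IsUnit N.toBlocks₂₂) :
    Realizable V s (schurComplement N) := by
  rw [Matrix.isUnit_iff_isUnit_det] at hu
  refine ⟨Fin l, inferInstance, inferInstance, N.toBlocks₁₁, N.toBlocks₁₂, N.toBlocks₂₁,
    N.toBlocks₂₂, N.toBlocks₂₂⁻¹ * N.toBlocks₂₁,
    ⟨fun _ _ => hN _ _, fun _ _ => hN _ _, fun _ _ => hN _ _, fun _ _ => hN _ _⟩, hu, ?_,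
    by rw [← Matrix.mul_assoc, schurComplement], fun h => ?_⟩
  · rw [← Matrix.mul_assoc, Matrix.mul_nonsing_inv _ hu, Matrix.one_mul]
  · refine ⟨?_, ?_, ?_⟩ <;> ext i j <;> exact congr_fun₂ (hs h) _ _

theorem Realizable.exists_schurComplement {t : K} (ht : t ∈ V) (ht0 : t ≠ 0)
    {M : Matrix (Fin k) (Fin k) K} (hM : Realizable V s M) :
    ∃ l : ℕ, 0 < l ∧ ∃ N : Matrix (Fin k ⊕ Fin l) (Fin k ⊕ Fin l) K, (∀ i j, N i j ∈ V) ∧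
      (s → Nᵀ = N) ∧ IsUnit N.toBlocks₂₂ ∧ M = schurComplement N := by
  obtain ⟨ι, _, _, A, B, C, D, X, ⟨hA, hB, hC, hD⟩, hu, hX, rfl, hs⟩ := hM
  obtain ⟨m, ⟨e⟩⟩ := Finite.exists_equiv_fin ι
  let e' : ι ⊕ Unit ≃ Fin (m + 1) :=
    (Equiv.sumCongr e (Equiv.ofUnique Unit (Fin 1))).trans finSumFinEquiv
  -- A decoupled 1 × 1 block `t` makes the eliminated block nonempty, as `0 < l` demands, without
  -- changing the Schur complement.
  let T : Matrix Unit Unit K := .of fun _ _ => t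
  have hD' : IsUnit (Matrix.fromBlocks D 0 0 T).det := by
    rw [Matrix.det_fromBlocks_zero₂₁]
    exact hu.mul (by simpa [T] using ht0)
  refine ⟨m + 1, m.succ_pos, Matrix.fromBlocks A ((Matrix.fromCols B 0).submatrix id e'.symm)
    ((Matrix.fromRows C (0 : Matrix Unit (Fin k) K)).submatrix e'.symm id)
    ((Matrix.fromBlocks D 0 0 T).submatrix e'.symm e'.symm),
    fromBlocks_mem hA (fun i j => fromCols_mem hB (by simp) _ _)
      (fun i j => fromRows_mem hC (by simp) _ _)
      (fun i j => fromBlocks_mem hD (by simp) (by simp) (by simp [T, ht]) _ _), fun h => ?_, ?_, ?_⟩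
  · obtain ⟨h₁, h₂, h₃⟩ := hs h
    rw [Matrix.fromBlocks_transpose, Matrix.fromBlocks_inj]
    refine ⟨h₁, ?_, ?_, ?_⟩
    · rw [Matrix.transpose_submatrix, Matrix.transpose_fromRows, h₂]
      simp
    · rw [Matrix.transpose_submatrix, Matrix.transpose_fromCols, h₂]
      simp
    · rw [Matrix.transpose_submatrix, Matrix.fromBlocks_transpose, h₃]
      rfl
  · rw [Matrix.toBlocks_fromBlocks₂₂, Matrix.isUnit_iff_isUnit_det, Matrix.det_submatrix_equiv_self]
    exact hD'
  · have hinv : (Matrix.fromBlocks D 0 0 T)⁻¹ *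
        Matrix.fromRows C (0 : Matrix Unit (Fin k) K) =
          Matrix.fromRows X (0 : Matrix Unit (Fin k) K) := by
      have h : Matrix.fromBlocks D 0 0 T * Matrix.fromRows X (0 : Matrix Unit (Fin k) K) =
          Matrix.fromRows C (0 : Matrix Unit (Fin k) K) := by
        rw [Matrix.fromBlocks_mul_fromRows, hX]
        simp
      rw [← h, ← Matrix.mul_assoc, Matrix.nonsing_inv_mul _ hD', Matrix.one_mul]
    rw [schurComplement, Matrix.toBlocks_fromBlocks₁₁, Matrix.toBlocks_fromBlocks₁₂,
      Matrix.toBlocks_fromBlocks₂₁, Matrix.toBlocks_fromBlocks₂₂, Matrix.inv_submatrix_equiv,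
      Matrix.mul_assoc, Matrix.submatrix_mul_equiv, hinv, Matrix.submatrix_mul_equiv,
      Matrix.fromCols_mul_fromRows]
    simp

end Pencils

/-! ### Realizations as instances of `Realizable`, and the cases of few indeterminates. -/

section Equivalences

variable {F : Type*} [Field F] {n k : ℕ} {M : Matrix (Fin k) (Fin k) (RationalField F n)}

theorem hasBR_iff : HasBR M ↔ Realizable (affineForms F n) False M := by
  constructor
  · rintro ⟨l, -, A, hu, rfl⟩
    exact realizable_schurComplement A.toMatrix_mem_affineForms False.elim hu
  · intro h
    obtain ⟨l, hl, N, hN, -, hu, hM⟩ := h.exists_schurComplement one_mem_affineForms one_ne_zero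
    obtain ⟨A, rfl, -⟩ := exists_pencil hN
    exact ⟨l, hl, A, hu, hM⟩

theorem hasSBR_iff : HasSBR M ↔ Realizable (affineForms F n) True M := by
  constructor
  · rintro ⟨l, -, A, hA, hu, rfl⟩
    exact realizable_schurComplement A.toMatrix_mem_affineForms (fun _ => hA.toMatrix_transpose) hu
  · intro h
    obtain ⟨l, hl, N, hN, hs, hu, hM⟩ := h.exists_schurComplement one_mem_affineForms one_ne_zero
    obtain ⟨A, rfl, hA⟩ := exists_pencil hN
    exact ⟨l, hl, A, hA (hs trivial), hu, hM⟩

theorem hasHBR_iff (hn : 0 < n) : HasHBR M ↔ Realizable (linearForms F n) False M := by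
  constructor
  · rintro ⟨l, -, A, hA, hu, rfl⟩
    exact realizable_schurComplement hA.toMatrix_mem_linearForms False.elim hu
  · intro h
    obtain ⟨l, hl, N, hN, -, hu, hM⟩ :=
      h.exists_schurComplement (indet_mem_linearForms ⟨0, hn⟩) (indet_ne_zero _)
    obtain ⟨A, rfl, hA, -⟩ := exists_homogeneous_pencil hN
    exact ⟨l, hl, A, hA, hu, hM⟩

theorem hasHSBR_iff (hn : 0 < n) : HasHSBR M ↔ Realizable (linearForms F n) True M := by
  constructor
  · rintro ⟨l, -, A, hA, hA', hu, rfl⟩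
    exact realizable_schurComplement hA.toMatrix_mem_linearForms
      (fun _ => hA'.toMatrix_transpose) hu
  · intro h
    obtain ⟨l, hl, N, hN, hs, hu, hM⟩ :=
      h.exists_schurComplement (indet_mem_linearForms ⟨0, hn⟩) (indet_ne_zero _)
    obtain ⟨A, rfl, hA, hA'⟩ := exists_homogeneous_pencil hN
    exact ⟨l, hl, A, hA, hA' (hs trivial), hu, hM⟩

theorem mem_weightedSquareSpan_affineForms (f : RationalField F 1) :
    f ∈ weightedSquareSpan (affineForms F 1) 1 :=
  mem_weightedSquareSpan_of_pair one_ne_zero one_mem_affineForms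
    (linearForms_le_affineForms (indet_mem_linearForms 0))
    (Submodule.span_mono (by rw [Set.range_unique]; rfl)) (mem_adjoin_affineForms _)

theorem mem_weightedSquareSpan_linearForms (hn : n = 1 ∨ n = 2) (i₀ : Fin n)
    {f : RationalField F n} (hf : IsHomogeneousRat 1 f) :
    f ∈ weightedSquareSpan (linearForms F n) (indet F i₀) := by
  -- For `n = 1` the second spanning element coincides with the first.
  obtain ⟨i₁, hi⟩ : ∃ i₁ : Fin n, ∀ i, i = i₀ ∨ i = i₁ := by
    rcases hn with rfl | rfl
    · exact ⟨i₀, fun i => .inl (Subsingleton.elim _ _)⟩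
    · exact ⟨i₀ + 1, fun i => by lia⟩
  refine mem_weightedSquareSpan_of_pair (indet_ne_zero i₀) (indet_mem_linearForms i₀)
    (indet_mem_linearForms i₁) (show linearForms F n ≤ _ from Submodule.span_mono ?_) ?_
  · rintro _ ⟨i, rfl⟩
    rcases hi i with rfl | rfl <;> simp
  · simpa using IsHomogeneousRat.div_pow_mem_adjoin (d := 1) hf i₀

theorem charP_two_of_ringChar_eq (h : ringChar F = 2) : CharP F 2 := h ▸ ringChar.charP F

end Equivalences

end Bessmertnyi

end

/-! ### The main theorem. -/

theorem theorem1p1 {F : Type*} [Field F] (n k : ℕ) (hn : 1 ≤ n)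
    (M : Matrix (Fin k) (Fin k) (Bessmertnyi.RationalField F n)) :
    Bessmertnyi.HasBR M ∧
    (Bessmertnyi.HasHBR M ↔ ∀ i j, Bessmertnyi.IsHomogeneousRat 1 (M i j)) ∧
    (Bessmertnyi.HasSBR M ↔
      Mᵀ = M ∧
        (n = 1 ∨ ringChar F ≠ 2 ∨
          (2 ≤ n ∧ ringChar F = 2 ∧ ∀ i, M i i ∈ Bessmertnyi.squareSpan F n))) ∧
    (Bessmertnyi.HasHSBR M ↔
      (∀ i j, Bessmertnyi.IsHomogeneousRat 1 (M i j)) ∧ Mᵀ = M ∧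
        ((n = 1 ∨ n = 2) ∨ ringChar F ≠ 2 ∨
          (3 ≤ n ∧ ringChar F = 2 ∧
            ∀ i, M i i ∈ Bessmertnyi.homogeneousSquareSpan F n))) := by
  open Bessmertnyi in
  have haff : Realizable (affineForms F n) False M :=
    realizable_false one_mem_affineForms one_ne_zero fun i j => mem_adjoin_affineForms _
  -- Serves both `n = 1`, where the diagonal condition is automatic, and the span condition in
  -- characteristic 2.
  have hsymm (hs : Mᵀ = M) (hd : ∀ i, M i i ∈ weightedSquareSpan (affineForms F n) 1) :
      Realizable (affineForms F n) True M :=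
    realizable_true_of_diag_mem_span (t := (1 : RationalField F n)) one_mem_affineForms one_ne_zero
      (fun _ _ => mem_adjoin_affineForms _) hs hd
  obtain ⟨i₀⟩ : Nonempty (Fin n) := ⟨⟨0, hn⟩⟩
  have hmem (h : ∀ i j, IsHomogeneousRat 1 (M i j)) (i j : Fin k) : M i j / indet F i₀ ∈
      IntermediateField.adjoin F {a | indet F i₀ * a ∈ linearForms F n} := by
    simpa using IsHomogeneousRat.div_pow_mem_adjoin (d := 1) (h i j) i₀
  have hlin (h : ∀ i j, IsHomogeneousRat 1 (M i j)) : Realizable (linearForms F n) False M :=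
    realizable_false (indet_mem_linearForms i₀) (indet_ne_zero i₀) (hmem h)
  rw [hasBR_iff, hasHBR_iff hn, hasSBR_iff, hasHSBR_iff hn]
  refine ⟨haff, ⟨fun h => h.isHomogeneousRat, hlin⟩, ⟨fun h => ⟨h.transpose_eq, ?_⟩, ?_⟩,
    ⟨fun h => ⟨h.isHomogeneousRat, h.transpose_eq, ?_⟩, ?_⟩⟩
  · by_cases hF : ringChar F = 2
    · have := charP_two_of_ringChar_eq hF
      rcases hn.eq_or_lt with h1 | h1
      · exact .inl h1.symm
      · exact .inr (.inr ⟨h1, hF, h.diag_mem_squareSpan⟩)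
    · exact .inr (.inl hF)
  · rintro ⟨hs, rfl | hF | ⟨-, -, hd⟩⟩
    · exact hsymm hs fun _ => mem_weightedSquareSpan_affineForms _
    · exact realizable_true_of_two_ne_zero (Ring.two_ne_zero hF) haff hs
    · exact hsymm hs fun i => squareSpan_le (hd i)
  · by_cases hF : ringChar F = 2
    · have := charP_two_of_ringChar_eq hF
      by_cases h2 : n = 1 ∨ n = 2
      · exact .inl h2
      · exact .inr (.inr ⟨by lia, hF, h.diag_mem_homogeneousSquareSpan⟩)
    · exact .inr (.inl hF)
  · rintro ⟨hh, hs, h⟩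
    have hsymm (hd : ∀ i, M i i ∈ weightedSquareSpan (linearForms F n) (indet F i₀)) :
        Realizable (linearForms F n) True M :=
      realizable_true_of_diag_mem_span (indet_mem_linearForms i₀) (indet_ne_zero i₀) (hmem hh) hs hd
    rcases h with h12 | hF | ⟨-, -, hd⟩
    · exact hsymm fun i => mem_weightedSquareSpan_linearForms h12 i₀ (hh i i)
    · exact realizable_true_of_two_ne_zero (Ring.two_ne_zero hF) (hlin hh) hs
    · exact hsymm fun i => homogeneousSquareSpan_le i₀ (hd i)
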